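/- **Definitions.** A *duoidal category* is a category $\mathbb X$ with two monoidal structures $(\otimes,\top)$ and $(\triangleright,\bot)$, a natural transformation $\mathsf{duo}:(a\triangleright b)\otimes(c\triangleright d)\to(a\otimes c)\triangleright(b\otimes d)$ and maps $e_\top:\top\to\top\triangleright\top$, $e_\bot:\bot\otimes\bot\to\bot$, $\iota:\top\to\bot$ such that $(\mathsf{duo},e_\top)$ makes $\triangleright:\mathbb X\times\mathbb X\to\mathbb X$ a $\otimes$-lax monoidal functor, $(e_\bot,\iota)$ makes $\bot:\mathbb 1\to\mathbb X$ a $\otimes$-lax monoidal functor (i.e. $\bot$ a $\otimes$-monoid), and the associator and unitors of $(\triangleright,\bot)$ are $\otimes$-monoidal natural transformations. Let $k:\top\to\bot$ be the composite $$\top\cong\top\otimes\top\cong(\top\triangleright\bot)\otimes(\bot\triangleright\top)\xrightarrow{\mathsf{duo}}(\top\otimes\bot)\triangleright(\bot\otimes\top)\cong\bot\triangleright\bot\cong\bot .$$ The duoidal category is *normal* if $k$ is an isomorphism. A *bilax duoidal functor* is a functor $F$ with a $\otimes$-lax monoidal structure $(m_\otimes,m_I)$ and a $\triangleright$-colax monoidal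 structure $(n_\triangleright,n_I)$ such that (composites written in diagrammatic order) - [D.1] $m_\otimes;F(\mathsf{duo});n_\triangleright=(n_\triangleright\otimes n_\triangleright);\mathsf{duo};(m_\otimes\triangleright m_\otimes)$ as maps $F(a\triangleright b)\otimes F(c\triangleright d)\to F(a\otimes c)\triangleright F(b\otimes d)$, - [D.2] $m_I;F(e_\top);n_\triangleright=e_\top;(m_I\triangleright m_I)$, - [D.3] $m_\otimes;F(e_\bot);n_I=(n_I\otimes n_I);e_\bot$, - [D.4] $m_I;F(k);n_I=k$. It is *normal* if $m_I:\top\to F(\top)$ and $n_I:F(\bot)\to\bot$ are isomorphisms. A (planar) *linearly distributive category* (LDC) is a category with monoidal structures $(\otimes,\top)$, $(\triangleright,\bot)$ and natural transformations $\partial^L:a\otimes(b\triangleright c)\to(a\otimes b)\triangleright c$ and $\partial^R:(b\triangleright c)\otimes a\to b\triangleright(c\otimes a)$ satisfying the usual ten coherence laws (of Cockett and Seely) with the unitors of $\otimes$ and of $\triangleright$, with the associators of $\otimes$ and of $\triangleright$, and with each other. An *isomix LDC* is an LDC with an isomorphism $\mathsf m:\bot\to\top$ (the mix map) for which the two induced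 maps $a\otimes b\to a\triangleright b$, $$a\otimes b\cong a\otimes(\bot\triangleright b)\xrightarrow{\mathsf m}a\otimes(\top\triangleright b)\xrightarrow{\partial^L}(a\otimes\top)\triangleright b\cong a\triangleright b,\qquad a\otimes b\cong(a\triangleright\bot)\otimes b\xrightarrow{\partial^R}a\triangleright(\bot\otimes b)\xrightarrow{\mathsf m}a\triangleright(\top\otimes b)\cong a\triangleright b,$$ agree. A *Frobenius functor* between LDCs is a functor with a $\otimes$-lax structure $(m_\otimes,m_I)$ and a $\triangleright$-colax structure $(n_\triangleright,n_I)$ such that - [F.1] $m_\otimes;F(\partial^L);n_\triangleright=(\mathrm{id}\otimes n_\triangleright);\partial^L;(m_\otimes\triangleright\mathrm{id})$ as maps $F(a)\otimes F(b\triangleright c)\to F(a\otimes b)\triangleright F(c)$, - [F.2] $m_\otimes;F(\partial^R);n_\triangleright=(n_\triangleright\otimes\mathrm{id});\partial^R;(\mathrm{id}\triangleright m_\otimes)$ as maps $F(a\triangleright b)\otimes F(c)\to F(a)\triangleright F(b\otimes c)$. A Frobenius functor between isomix LDCs is *isomix* if $n_I;\mathsf m;m_I=F(\mathsf m)$ and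 $m_I$, $n_I$ are isomorphisms. **Lemma.** Let $\mathsf{normalDuo}$ be the category of normal duoidal categories and normal bilax duoidal functors, and $\mathsf{Isomix}$ the category of isomix LDCs and isomix Frobenius functors. There is a faithful functor $H:\mathsf{normalDuo}\to\mathsf{Isomix}$ that keeps the underlying category with its two monoidal structures, and the underlying functor with its lax and colax structures. On objects, $H(\mathbb X)$ is $\mathbb X$ with mix map $\mathsf m=k^{-1}$ and distributors $$\partial^L:\ a\otimes(b\triangleright c)\cong(a\triangleright\bot)\otimes(b\triangleright c)\xrightarrow{\mathsf{duo}}(a\otimes b)\triangleright(\bot\otimes c)\xrightarrow{k^{-1}}(a\otimes b)\triangleright(\top\otimes c)\cong(a\otimes b)\triangleright c,$$ $$\partial^R:\ (b\triangleright c)\otimes a\cong(b\triangleright c)\otimes(\bot\triangleright a)\xrightarrow{\mathsf{duo}}(b\otimes\bot)\triangleright(c\otimes a)\xrightarrow{k^{-1}}(b\otimes\top)\triangleright(c\otimes a)\cong b\triangleright(c\otimes a).$$ In particular, these data make every normal duoidal category an isomix LDC, and with respect to them every normal bilax duoidal functor satisfies [F.1] and [F.2] and is isomix. -/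

import Mathlib

open CategoryTheory MonoidalCategory

universe v u

namespace Duoidal

/-! ### A second monoidal structure on a category

The parallel structure `(⊗, ⊤)` of a category `C` is Mathlib's `MonoidalCategory C`, with
`⊤ = 𝟙_ C`. The sequential structure `(⊳, ⊥)` is a second, unrelated, monoidal structure. -/

/-- A (second) monoidal structure `(⊳, ⊥)` on the category `C`. -/
class SeqMonoidalCategory (C : Type u) [Category.{v} C] where
  /-- the monoidal structure -/
  str : MonoidalCategory C

section Seq

variable {C : Type u} [Category.{v} C] [S : SeqMonoidalCategory C]

/-- The sequential product of objects. -/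
abbrev seqObj (a b : C) : C := S.str.tensorObj a b

/-- The sequential product of morphisms. -/
abbrev seqHom {a a' b b' : C} (f : a ⟶ a') (g : b ⟶ b') : seqObj a b ⟶ seqObj a' b' :=
  S.str.tensorHom f g

/-- The unit `⊥` of the sequential product. -/
abbrev seqUnit (C : Type u) [Category.{v} C] [S : SeqMonoidalCategory C] : C :=
  S.str.tensorUnit

/-- The associator of the sequential product. -/
abbrev seqAssoc (a b c : C) : seqObj (seqObj a b) c ≅ seqObj a (seqObj b c) :=
  S.str.associator a b c

/-- The left unitor of the sequential product. -/
abbrev seqLeft (a : C) : seqObj (seqUnit C) a ≅ a := S.str.leftUnitor a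

/-- The right unitor of the sequential product. -/
abbrev seqRight (a : C) : seqObj a (seqUnit C) ≅ a := S.str.rightUnitor a

end Seq

infixr:70 " ⊳ " => seqObj
infixr:70 " ⊳ₘ " => seqHom
notation "𝕁_ " C:max => seqUnit C

/-- A colax monoidal structure on a functor, for the sequential products. -/
abbrev SeqColax {C D : Type u} [Category.{v} C] [SC : SeqMonoidalCategory C]
    [Category.{v} D] [SD : SeqMonoidalCategory D] (F : C ⥤ D) :=
  @Functor.OplaxMonoidal C _ SC.str D _ SD.str F

namespace SeqColax

variable {C D E : Type u} [Category.{v} C] [SC : SeqMonoidalCategory C]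
  [Category.{v} D] [SD : SeqMonoidalCategory D] [Category.{v} E] [SE : SeqMonoidalCategory E]

/-- The colaxor `F (a ⊳ b) ⟶ F a ⊳ F b`. -/
abbrev n {F : C ⥤ D} (h : SeqColax F) (a b : C) : F.obj (a ⊳ b) ⟶ F.obj a ⊳ F.obj b :=
  @Functor.OplaxMonoidal.δ C _ SC.str D _ SD.str F h a b

/-- The unit colaxor `F ⊥ ⟶ ⊥`. -/
abbrev nI {F : C ⥤ D} (h : SeqColax F) : F.obj (𝕁_ C) ⟶ 𝕁_ D :=
  @Functor.OplaxMonoidal.η C _ SC.str D _ SD.str F h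

/-- The identity functor is colax. -/
abbrev id (C : Type u) [Category.{v} C] [SC : SeqMonoidalCategory C] : SeqColax (𝟭 C) :=
  @Functor.OplaxMonoidal.id C _ SC.str

/-- The composite of colax functors is colax. -/
abbrev comp {F : C ⥤ D} {G : D ⥤ E} (hF : SeqColax F) (hG : SeqColax G) :
    SeqColax (F ⋙ G) :=
  @Functor.OplaxMonoidal.comp C _ SC.str D _ SD.str E _ SE.str F G hF hG

end SeqColax

/-! ### Categories with two monoidal structures -/

/-- A category with two monoidal structures `(⊗, ⊤)` and `(⊳, ⊥)`, not required to interact. -/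
structure BiMonCat : Type (max (u + 1) (v + 1)) where
  /-- the objects -/
  carrier : Type u
  [cat : Category.{v} carrier]
  [tensor : MonoidalCategory carrier]
  [seq : SeqMonoidalCategory carrier]

attribute [instance] BiMonCat.cat BiMonCat.tensor BiMonCat.seq

/-- A functor that is `⊗`-lax monoidal and `⊳`-colax monoidal. -/
structure BiMonCat.Hom (X Y : BiMonCat.{v, u}) where
  /-- the functor -/
  functor : X.carrier ⥤ Y.carrier
  /-- the lax structure for `⊗` -/
  lax : functor.LaxMonoidal
  /-- the colax structure for `⊳` -/
  colax : SeqColax functor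

namespace BiMonCat.Hom

variable {X Y : BiMonCat.{v, u}} (F : BiMonCat.Hom X Y)

/-- The action of the functor on objects. -/
abbrev obj (a : X.carrier) : Y.carrier := F.functor.obj a

/-- The action of the functor on morphisms. -/
abbrev map {a b : X.carrier} (f : a ⟶ b) : F.obj a ⟶ F.obj b := F.functor.map f

/-- The laxor `F a ⊗ F b ⟶ F (a ⊗ b)`. -/
abbrev m (a b : X.carrier) : F.obj a ⊗ F.obj b ⟶ F.obj (a ⊗ b) :=
  @Functor.LaxMonoidal.μ _ _ _ _ _ _ F.functor F.lax a b

/-- The unit laxor `⊤ ⟶ F ⊤`. -/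
abbrev mI : 𝟙_ Y.carrier ⟶ F.obj (𝟙_ X.carrier) :=
  @Functor.LaxMonoidal.ε _ _ _ _ _ _ F.functor F.lax

/-- The colaxor `F (a ⊳ b) ⟶ F a ⊳ F b`. -/
abbrev n (a b : X.carrier) : F.obj (a ⊳ b) ⟶ F.obj a ⊳ F.obj b := F.colax.n a b

/-- The unit colaxor `F ⊥ ⟶ ⊥`. -/
abbrev nI : F.obj (𝕁_ X.carrier) ⟶ 𝕁_ Y.carrier := F.colax.nI

end BiMonCat.Hom

instance : Category BiMonCat.{v, u} where
  Hom := BiMonCat.Hom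
  id X := ⟨𝟭 X.carrier, inferInstance, SeqColax.id X.carrier⟩
  comp F G := ⟨F.functor ⋙ G.functor,
    @Functor.LaxMonoidal.comp _ _ _ _ _ _ _ _ _ F.functor G.functor F.lax G.lax,
    F.colax.comp G.colax⟩
  id_comp F := by
    obtain ⟨F, l, c⟩ := F
    congr 1
    · refine Functor.LaxMonoidal.ext ?_ ?_
      · simp; rfl
      · ext; simp; rfl
    · refine @Functor.OplaxMonoidal.ext _ _ (_) _ _ (_) _ _ _ ?_ ?_
      · simp; rfl
      · ext; simp; rfl
  comp_id F := by
    obtain ⟨F, l, c⟩ := F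
    congr 1
    · refine Functor.LaxMonoidal.ext ?_ ?_
      · simp; rfl
      · ext; simp; rfl
    · refine @Functor.OplaxMonoidal.ext _ _ (_) _ _ (_) _ _ _ ?_ ?_
      · simp; rfl
      · ext; simp; rfl
  assoc F G H := by
    congr 1
    · refine Functor.LaxMonoidal.ext ?_ ?_
      · simp; exact (Category.assoc _ _ _).symm
      · ext; simp; exact (Category.assoc _ _ _).symm
    · refine @Functor.OplaxMonoidal.ext _ _ (_) _ _ (_) _ _ _ ?_ ?_
      · simp; rfl
      · ext; simp; rfl

/-! ### Normal duoidal categories -/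

/-- A duoidal category. The three data below, together with `unit : ⊤ ⟶ ⊥`, make the functors
`⊳ : C × C ⥤ C` and `⊥ : 1 ⥤ C` lax monoidal for `⊗`, in such a way that the associator and the
unitors of `⊳` are `⊗`-monoidal natural transformations. -/
class DuoidalCategory (C : Type u) [Category.{v} C] [MonoidalCategory C]
    [SeqMonoidalCategory C] where
  /-- the interchange law -/
  duo (a b c d : C) : (a ⊳ b) ⊗ (c ⊳ d) ⟶ (a ⊗ c) ⊳ (b ⊗ d)
  /-- the unit laxor of the functor `⊳` -/
  eTop : 𝟙_ C ⟶ 𝟙_ C ⊳ 𝟙_ C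
  /-- the laxor of the functor `⊥` -/
  eBot : 𝕁_ C ⊗ 𝕁_ C ⟶ 𝕁_ C
  /-- the unit laxor of the functor `⊥` -/
  unit : 𝟙_ C ⟶ 𝕁_ C
  /- the functor `⊳` is lax monoidal -/
  duo_natural {a a' b b' c c' d d' : C} (f : a ⟶ a') (g : b ⟶ b') (h : c ⟶ c') (i : d ⟶ d') :
    ((f ⊳ₘ g) ⊗ₘ (h ⊳ₘ i)) ≫ duo a' b' c' d' = duo a b c d ≫ ((f ⊗ₘ h) ⊳ₘ (g ⊗ₘ i))
  duo_tensor_assoc (a b c d e f : C) :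
    (duo a b c d ⊗ₘ 𝟙 (e ⊳ f)) ≫ duo (a ⊗ c) (b ⊗ d) e f ≫ ((α_ a c e).hom ⊳ₘ (α_ b d f).hom) =
      (α_ (a ⊳ b) (c ⊳ d) (e ⊳ f)).hom ≫ (𝟙 (a ⊳ b) ⊗ₘ duo c d e f) ≫
        duo a b (c ⊗ e) (d ⊗ f)
  duo_left_unit (a b : C) :
    (eTop ⊗ₘ 𝟙 (a ⊳ b)) ≫ duo (𝟙_ C) (𝟙_ C) a b ≫ ((λ_ a).hom ⊳ₘ (λ_ b).hom) =
      (λ_ (a ⊳ b)).hom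
  duo_right_unit (a b : C) :
    (𝟙 (a ⊳ b) ⊗ₘ eTop) ≫ duo a b (𝟙_ C) (𝟙_ C) ≫ ((ρ_ a).hom ⊳ₘ (ρ_ b).hom) =
      (ρ_ (a ⊳ b)).hom
  /- the functor `⊥` is lax monoidal -/
  eBot_assoc :
    (eBot ⊗ₘ 𝟙 (𝕁_ C)) ≫ eBot = (α_ (𝕁_ C) (𝕁_ C) (𝕁_ C)).hom ≫ (𝟙 (𝕁_ C) ⊗ₘ eBot) ≫ eBot
  unit_eBot : (unit ⊗ₘ 𝟙 (𝕁_ C)) ≫ eBot = (λ_ (𝕁_ C)).hom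
  eBot_unit : (𝟙 (𝕁_ C) ⊗ₘ unit) ≫ eBot = (ρ_ (𝕁_ C)).hom
  /- the associator of `⊳` is monoidal -/
  duo_seq_assoc (a b c d e f : C) :
    duo (a ⊳ b) c (d ⊳ e) f ≫ (duo a b d e ⊳ₘ 𝟙 (c ⊗ f)) ≫
        (seqAssoc (a ⊗ d) (b ⊗ e) (c ⊗ f)).hom =
      ((seqAssoc a b c).hom ⊗ₘ (seqAssoc d e f).hom) ≫ duo a (b ⊳ c) d (e ⊳ f) ≫
        (𝟙 (a ⊗ d) ⊳ₘ duo b c e f)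
  eTop_assoc :
    eTop ≫ (eTop ⊳ₘ 𝟙 (𝟙_ C)) ≫ (seqAssoc (𝟙_ C) (𝟙_ C) (𝟙_ C)).hom =
      eTop ≫ (𝟙 (𝟙_ C) ⊳ₘ eTop)
  /- the left unitor of `⊳` is monoidal -/
  duo_seqLeft (a b : C) :
    duo (𝕁_ C) a (𝕁_ C) b ≫ (eBot ⊳ₘ 𝟙 (a ⊗ b)) ≫ (seqLeft (a ⊗ b)).hom =
      (seqLeft a).hom ⊗ₘ (seqLeft b).hom
  eTop_seqLeft : eTop ≫ (unit ⊳ₘ 𝟙 (𝟙_ C)) ≫ (seqLeft (𝟙_ C)).hom = 𝟙 (𝟙_ C)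
  /- the right unitor of `⊳` is monoidal -/
  duo_seqRight (a b : C) :
    duo a (𝕁_ C) b (𝕁_ C) ≫ (𝟙 (a ⊗ b) ⊳ₘ eBot) ≫ (seqRight (a ⊗ b)).hom =
      (seqRight a).hom ⊗ₘ (seqRight b).hom
  eTop_seqRight : eTop ≫ (𝟙 (𝟙_ C) ⊳ₘ unit) ≫ (seqRight (𝟙_ C)).hom = 𝟙 (𝟙_ C)

open DuoidalCategory

/-- The map `k : ⊤ ⟶ ⊥`, the composite
`⊤ ≅ ⊤ ⊗ ⊤ ≅ (⊤ ⊳ ⊥) ⊗ (⊥ ⊳ ⊤) ⟶ (⊤ ⊗ ⊥) ⊳ (⊥ ⊗ ⊤) ≅ ⊥ ⊳ ⊥ ≅ ⊥` through the interchange law. -/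
def kMap (C : Type u) [Category.{v} C] [MonoidalCategory C] [SeqMonoidalCategory C]
    [DuoidalCategory C] : 𝟙_ C ⟶ 𝕁_ C :=
  (λ_ (𝟙_ C)).inv ≫ ((seqRight (𝟙_ C)).inv ⊗ₘ (seqLeft (𝟙_ C)).inv) ≫
    duo (𝟙_ C) (𝕁_ C) (𝕁_ C) (𝟙_ C) ≫ ((λ_ (𝕁_ C)).hom ⊳ₘ (ρ_ (𝕁_ C)).hom) ≫
      (seqLeft (𝕁_ C)).hom

/-- A normal duoidal category: a duoidal category in which `k : ⊤ ⟶ ⊥` is invertible. -/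
structure NormalDuo extends BiMonCat.{v, u} where
  [duoidal : DuoidalCategory carrier]
  [normal : IsIso (kMap carrier)]

attribute [instance] NormalDuo.duoidal NormalDuo.normal

/-- The conditions for a `⊗`-lax and `⊳`-colax functor between duoidal categories to be a bilax
duoidal functor. -/
structure IsBilax {X Y : BiMonCat.{v, u}} [DuoidalCategory X.carrier] [DuoidalCategory Y.carrier]
    (F : X ⟶ Y) : Prop where
  d1 (a b c d : X.carrier) :
    F.m (a ⊳ b) (c ⊳ d) ≫ F.map (duo a b c d) ≫ F.n (a ⊗ c) (b ⊗ d) =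
      (F.n a b ⊗ₘ F.n c d) ≫ duo (F.obj a) (F.obj b) (F.obj c) (F.obj d) ≫ (F.m a c ⊳ₘ F.m b d)
  d2 : F.mI ≫ F.map eTop ≫ F.n (𝟙_ X.carrier) (𝟙_ X.carrier) = eTop ≫ (F.mI ⊳ₘ F.mI)
  d3 : F.m (𝕁_ X.carrier) (𝕁_ X.carrier) ≫ F.map eBot ≫ F.nI = (F.nI ⊗ₘ F.nI) ≫ eBot
  d4 : F.mI ≫ F.map (kMap X.carrier) ≫ F.nI = kMap Y.carrier

/-- Both unit comparison maps `⊤ ⟶ F ⊤` and `F ⊥ ⟶ ⊥` are isomorphisms. -/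
structure UnitsIso {X Y : BiMonCat.{v, u}} (F : X ⟶ Y) : Prop where
  mI_iso : IsIso F.mI
  nI_iso : IsIso F.nI

/-- A normal bilax duoidal functor between normal duoidal categories. -/
@[ext]
structure NormalDuo.Hom (X Y : NormalDuo.{v, u}) where
  /-- the underlying lax and colax functor -/
  hom : X.toBiMonCat ⟶ Y.toBiMonCat
  bilax : IsBilax hom
  normal : UnitsIso hom

/-! ### Isomix linearly distributive categories -/

/-- The data of two linear distributors and a mix map. -/
@[ext]
structure MixData (C : Type u) [Category.{v} C] [MonoidalCategory C]
    [SeqMonoidalCategory C] where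
  /-- the left linear distributor -/
  distL (a b c : C) : a ⊗ (b ⊳ c) ⟶ (a ⊗ b) ⊳ c
  /-- the right linear distributor -/
  distR (b c a : C) : (b ⊳ c) ⊗ a ⟶ b ⊳ (c ⊗ a)
  /-- the mix map -/
  mix : 𝕁_ C ⟶ 𝟙_ C

section LDC

variable {C : Type u} [Category.{v} C] [MonoidalCategory C] [SeqMonoidalCategory C]

/-- The distributors are natural and satisfy the coherence laws of a (planar) linearly
distributive category. -/
structure MixData.IsLDC (D : MixData C) : Prop where
  distL_natural {a a' b b' c c' : C} (f : a ⟶ a') (g : b ⟶ b') (h : c ⟶ c') :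
    (f ⊗ₘ (g ⊳ₘ h)) ≫ D.distL a' b' c' = D.distL a b c ≫ ((f ⊗ₘ g) ⊳ₘ h)
  distR_natural {a a' b b' c c' : C} (g : b ⟶ b') (h : c ⟶ c') (f : a ⟶ a') :
    ((g ⊳ₘ h) ⊗ₘ f) ≫ D.distR b' c' a' = D.distR b c a ≫ (g ⊳ₘ (h ⊗ₘ f))
  /- distributors and the unitors of `⊗` -/
  distL_leftUnitor (b c : C) :
    D.distL (𝟙_ C) b c ≫ ((λ_ b).hom ⊳ₘ 𝟙 c) = (λ_ (b ⊳ c)).hom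
  distR_rightUnitor (b c : C) :
    D.distR b c (𝟙_ C) ≫ (𝟙 b ⊳ₘ (ρ_ c).hom) = (ρ_ (b ⊳ c)).hom
  /- distributors and the unitors of `⊳` -/
  distL_seqRight (a b : C) :
    D.distL a b (𝕁_ C) ≫ (seqRight (a ⊗ b)).hom = 𝟙 a ⊗ₘ (seqRight b).hom
  distR_seqLeft (c a : C) :
    D.distR (𝕁_ C) c a ≫ (seqLeft (c ⊗ a)).hom = (seqLeft c).hom ⊗ₘ 𝟙 a
  /- distributors and the associator of `⊗` -/
  distL_assoc (a b c d : C) :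
    D.distL (a ⊗ b) c d ≫ ((α_ a b c).hom ⊳ₘ 𝟙 d) =
      (α_ a b (c ⊳ d)).hom ≫ (𝟙 a ⊗ₘ D.distL b c d) ≫ D.distL a (b ⊗ c) d
  distR_assoc (a b c d : C) :
    (α_ (a ⊳ b) c d).hom ≫ D.distR a b (c ⊗ d) =
      (D.distR a b c ⊗ₘ 𝟙 d) ≫ D.distR a (b ⊗ c) d ≫ (𝟙 a ⊳ₘ (α_ b c d).hom)
  /- distributors and the associator of `⊳` -/
  distL_seqAssoc (a b c d : C) :
    D.distL a (b ⊳ c) d ≫ (D.distL a b c ⊳ₘ 𝟙 d) ≫ (seqAssoc (a ⊗ b) c d).hom =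
      (𝟙 a ⊗ₘ (seqAssoc b c d).hom) ≫ D.distL a b (c ⊳ d)
  distR_seqAssoc (b c d a : C) :
    D.distR (b ⊳ c) d a ≫ (seqAssoc b c (d ⊗ a)).hom =
      ((seqAssoc b c d).hom ⊗ₘ 𝟙 a) ≫ D.distR b (c ⊳ d) a ≫ (𝟙 b ⊳ₘ D.distR c d a)
  /- interaction of the two distributors -/
  distL_distR (a b c d : C) :
    (D.distL a b c ⊗ₘ 𝟙 d) ≫ D.distR (a ⊗ b) c d =
      (α_ a (b ⊳ c) d).hom ≫ (𝟙 a ⊗ₘ D.distR b c d) ≫ D.distL a b (c ⊗ d)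
  distR_distL (a b c d : C) :
    D.distL (a ⊳ b) c d ≫ (D.distR a b c ⊳ₘ 𝟙 d) ≫ (seqAssoc a (b ⊗ c) d).hom =
      D.distR a b (c ⊳ d) ≫ (𝟙 a ⊳ₘ D.distL b c d)

/-- The mix law: the two maps `a ⊗ b ⟶ a ⊳ b` induced by the mix map agree. -/
def MixData.IsMix (D : MixData C) : Prop :=
  ∀ a b : C,
    (𝟙 a ⊗ₘ (seqLeft b).inv) ≫ (𝟙 a ⊗ₘ (D.mix ⊳ₘ 𝟙 b)) ≫ D.distL a (𝟙_ C) b ≫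
        ((ρ_ a).hom ⊳ₘ 𝟙 b) =
      ((seqRight a).inv ⊗ₘ 𝟙 b) ≫ D.distR a (𝕁_ C) b ≫ (𝟙 a ⊳ₘ (D.mix ⊗ₘ 𝟙 b)) ≫
        (𝟙 a ⊳ₘ (λ_ b).hom)

/-- An isomix linearly distributive structure: a linearly distributive category with a mix map
that satisfies the mix law and is invertible. -/
structure MixData.IsIsomixLDC (D : MixData C) : Prop where
  isLDC : D.IsLDC
  isMix : D.IsMix
  mix_iso : IsIso D.mix

end LDC

/-- An isomix linearly distributive category. -/
structure Isomix extends BiMonCat.{v, u} where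
  /-- the linear distributors and the mix map -/
  data : MixData carrier
  isIsomix : data.IsIsomixLDC

/-- The conditions for a `⊗`-lax and `⊳`-colax functor to be a Frobenius functor. -/
structure IsFrobenius {X Y : BiMonCat.{v, u}} (D : MixData X.carrier) (E : MixData Y.carrier)
    (F : X ⟶ Y) : Prop where
  f1 (a b c : X.carrier) :
    F.m a (b ⊳ c) ≫ F.map (D.distL a b c) ≫ F.n (a ⊗ b) c =
      (𝟙 (F.obj a) ⊗ₘ F.n b c) ≫ E.distL (F.obj a) (F.obj b) (F.obj c) ≫
        (F.m a b ⊳ₘ 𝟙 (F.obj c))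
  f2 (a b c : X.carrier) :
    F.m (a ⊳ b) c ≫ F.map (D.distR a b c) ≫ F.n a (b ⊗ c) =
      (F.n a b ⊗ₘ 𝟙 (F.obj c)) ≫ E.distR (F.obj a) (F.obj b) (F.obj c) ≫
        (𝟙 (F.obj a) ⊳ₘ F.m b c)

/-- An isomix Frobenius functor: a Frobenius functor that preserves the mix maps and whose unit
comparison maps are invertible. -/
structure IsIsomixFrobenius {X Y : BiMonCat.{v, u}} (D : MixData X.carrier)
    (E : MixData Y.carrier) (F : X ⟶ Y) : Prop where
  frobenius : IsFrobenius D E F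
  mix : F.nI ≫ E.mix ≫ F.mI = F.map D.mix
  units : UnitsIso F

/-- A morphism of isomix linearly distributive categories: an isomix Frobenius functor. -/
@[ext]
structure Isomix.Hom (X Y : Isomix.{v, u}) where
  /-- the underlying lax and colax functor -/
  hom : X.toBiMonCat ⟶ Y.toBiMonCat
  isIsomix : IsIsomixFrobenius X.data Y.data hom

/-! ### The two categories -/

section Categories

variable {X Y Z : BiMonCat.{v, u}}

theorem BiMonCat.m_natural (F : X ⟶ Y) {a a' b b' : X.carrier} (f : a ⟶ a') (g : b ⟶ b') :
    (F.map f ⊗ₘ F.map g) ≫ F.m a' b' = F.m a b ≫ F.map (f ⊗ₘ g) :=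
  @Functor.LaxMonoidal.μ_natural _ _ _ _ _ _ F.functor F.lax _ _ _ _ f g

theorem BiMonCat.n_natural (F : X ⟶ Y) {a a' b b' : X.carrier} (f : a ⟶ a') (g : b ⟶ b') :
    F.n a b ≫ (F.map f ⊳ₘ F.map g) = F.map (f ⊳ₘ g) ≫ F.n a' b' :=
  @Functor.OplaxMonoidal.δ_natural _ _ X.seq.str _ _ Y.seq.str F.functor F.colax _ _ _ _ f g

theorem BiMonCat.seqHom_comp {a b c a' b' c' : X.carrier} (f : a ⟶ b) (g : b ⟶ c)
    (f' : a' ⟶ b') (g' : b' ⟶ c') : (f ≫ g) ⊳ₘ (f' ≫ g') = (f ⊳ₘ f') ≫ (g ⊳ₘ g') :=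
  (@MonoidalCategory.tensorHom_comp_tensorHom _ _ X.seq.str _ _ _ _ _ _ f f' g g').symm

theorem BiMonCat.tensorHom_comp {a b c a' b' c' : X.carrier} (f : a ⟶ b) (g : b ⟶ c)
    (f' : a' ⟶ b') (g' : b' ⟶ c') : (f ≫ g) ⊗ₘ (f' ≫ g') = (f ⊗ₘ f') ≫ (g ⊗ₘ g') :=
  (MonoidalCategory.tensorHom_comp_tensorHom f f' g g').symm

theorem BiMonCat.id_seq_id (a b : X.carrier) : (𝟙 a ⊳ₘ 𝟙 b) = 𝟙 (a ⊳ b) :=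
  @MonoidalCategory.id_tensorHom_id _ _ X.seq.str a b

theorem UnitsIso.id (X : BiMonCat.{v, u}) : UnitsIso (𝟙 X) :=
  ⟨inferInstanceAs (IsIso (𝟙 _)), inferInstanceAs (IsIso (𝟙 _))⟩

theorem UnitsIso.comp {F : X ⟶ Y} {G : Y ⟶ Z} (hF : UnitsIso F)
    (hG : UnitsIso G) : UnitsIso (F ≫ G) := by
  obtain ⟨_, _⟩ := hF
  obtain ⟨_, _⟩ := hG
  exact ⟨inferInstanceAs (IsIso (G.mI ≫ G.map F.mI)), inferInstanceAs (IsIso (G.map F.nI ≫ G.nI))⟩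

theorem IsBilax.id (X : BiMonCat.{v, u}) [DuoidalCategory X.carrier] : IsBilax (𝟙 X) where
  d1 a b c d := by
    change 𝟙 _ ≫ duo a b c d ≫ 𝟙 _ = (𝟙 _ ⊗ₘ 𝟙 _) ≫ duo a b c d ≫ (𝟙 _ ⊳ₘ 𝟙 _)
    rw [BiMonCat.id_seq_id]
    simp
  d2 := by
    change 𝟙 _ ≫ eTop ≫ 𝟙 _ = eTop ≫ (𝟙 _ ⊳ₘ 𝟙 _)
    rw [BiMonCat.id_seq_id]
    simp
  d3 := by
    change 𝟙 _ ≫ eBot ≫ 𝟙 _ = (𝟙 _ ⊗ₘ 𝟙 _) ≫ eBot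
    simp
  d4 := by
    change 𝟙 _ ≫ kMap X.carrier ≫ 𝟙 _ = kMap X.carrier
    simp

theorem IsBilax.comp [DuoidalCategory X.carrier]
    [DuoidalCategory Y.carrier] [DuoidalCategory Z.carrier] {F : X ⟶ Y} {G : Y ⟶ Z}
    (hF : IsBilax F) (hG : IsBilax G) : IsBilax (F ≫ G) where
  d1 a b c d := by
    change (G.m _ _ ≫ G.map (F.m _ _)) ≫ G.map (F.map (duo a b c d)) ≫
      (G.map (F.n _ _) ≫ G.n _ _) = ((G.map (F.n a b) ≫ G.n _ _) ⊗ₘ (G.map (F.n c d) ≫ G.n _ _)) ≫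
        duo _ _ _ _ ≫ ((G.m _ _ ≫ G.map (F.m a c)) ⊳ₘ (G.m _ _ ≫ G.map (F.m b d)))
    have h := congrArg G.map (hF.d1 a b c d)
    simp only [Functor.map_comp] at h
    rw [BiMonCat.tensorHom_comp, BiMonCat.seqHom_comp]
    simp only [Category.assoc]
    rw [reassoc_of% h, ← reassoc_of% BiMonCat.m_natural G (F.n a b) (F.n c d),
      ← BiMonCat.n_natural G (F.m a c) (F.m b d), reassoc_of% hG.d1]
  d2 := by
    change (G.mI ≫ G.map F.mI) ≫ G.map (F.map eTop) ≫ (G.map (F.n _ _) ≫ G.n _ _) =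
      eTop ≫ ((G.mI ≫ G.map F.mI) ⊳ₘ (G.mI ≫ G.map F.mI))
    have h := congrArg G.map hF.d2
    simp only [Functor.map_comp] at h
    rw [BiMonCat.seqHom_comp, ← reassoc_of% hG.d2, BiMonCat.n_natural]
    simp only [Category.assoc]
    rw [reassoc_of% h]
  d3 := by
    change (G.m _ _ ≫ G.map (F.m _ _)) ≫ G.map (F.map eBot) ≫ (G.map F.nI ≫ G.nI) =
      ((G.map F.nI ≫ G.nI) ⊗ₘ (G.map F.nI ≫ G.nI)) ≫ eBot
    have h := congrArg G.map hF.d3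
    simp only [Functor.map_comp] at h
    rw [BiMonCat.tensorHom_comp]
    simp only [Category.assoc]
    rw [← hG.d3, reassoc_of% BiMonCat.m_natural G F.nI F.nI, reassoc_of% h]
  d4 := by
    change (G.mI ≫ G.map F.mI) ≫ G.map (F.map (kMap X.carrier)) ≫ (G.map F.nI ≫ G.nI) = _
    have h := congrArg G.map hF.d4
    simp only [Functor.map_comp] at h
    simp only [Category.assoc]
    rw [reassoc_of% h, hG.d4]

theorem IsIsomixFrobenius.id (D : MixData X.carrier) :
    IsIsomixFrobenius D D (𝟙 X) where
  frobenius :=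
    { f1 := fun a b c => by
        change 𝟙 _ ≫ D.distL a b c ≫ 𝟙 _ = (𝟙 _ ⊗ₘ 𝟙 _) ≫ D.distL a b c ≫ (𝟙 _ ⊳ₘ 𝟙 _)
        rw [BiMonCat.id_seq_id]
        simp
      f2 := fun a b c => by
        change 𝟙 _ ≫ D.distR a b c ≫ 𝟙 _ = (𝟙 _ ⊗ₘ 𝟙 _) ≫ D.distR a b c ≫ (𝟙 _ ⊳ₘ 𝟙 _)
        rw [BiMonCat.id_seq_id]
        simp }
  mix := by
    change 𝟙 _ ≫ D.mix ≫ 𝟙 _ = D.mix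
    simp
  units := UnitsIso.id X

theorem IsIsomixFrobenius.comp {D : MixData X.carrier}
    {E : MixData Y.carrier} {E' : MixData Z.carrier} {F : X ⟶ Y} {G : Y ⟶ Z}
    (hF : IsIsomixFrobenius D E F) (hG : IsIsomixFrobenius E E' G) :
    IsIsomixFrobenius D E' (F ≫ G) where
  frobenius :=
    { f1 := fun a b c => by
        change (G.m _ _ ≫ G.map (F.m _ _)) ≫ G.map (F.map (D.distL a b c)) ≫
          (G.map (F.n _ _) ≫ G.n _ _) = (𝟙 _ ⊗ₘ (G.map (F.n b c) ≫ G.n _ _)) ≫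
            E'.distL _ _ _ ≫ ((G.m _ _ ≫ G.map (F.m a b)) ⊳ₘ 𝟙 _)
        have h := congrArg G.map (hF.frobenius.f1 a b c)
        simp only [Functor.map_comp] at h
        have e1 := BiMonCat.tensorHom_comp (𝟙 (G.obj (F.obj a))) (𝟙 _) (G.map (F.n b c)) (G.n _ _)
        have e2 := BiMonCat.seqHom_comp (G.m _ _) (G.map (F.m a b)) (𝟙 (G.obj (F.obj c))) (𝟙 _)
        simp only [Category.comp_id] at e1 e2
        rw [e1, e2]
        simp only [Category.assoc]
        rw [reassoc_of% h]
        have e3 := BiMonCat.n_natural G (F.m a b) (𝟙 (F.obj c))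
        have e4 := BiMonCat.m_natural G (𝟙 (F.obj a)) (F.n b c)
        simp only [CategoryTheory.Functor.map_id] at e3 e4
        rw [← e3, ← reassoc_of% e4, reassoc_of% hG.frobenius.f1]
      f2 := fun a b c => by
        change (G.m _ _ ≫ G.map (F.m _ _)) ≫ G.map (F.map (D.distR a b c)) ≫
          (G.map (F.n _ _) ≫ G.n _ _) = ((G.map (F.n a b) ≫ G.n _ _) ⊗ₘ 𝟙 _) ≫
            E'.distR _ _ _ ≫ (𝟙 _ ⊳ₘ (G.m _ _ ≫ G.map (F.m b c)))
        have h := congrArg G.map (hF.frobenius.f2 a b c)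
        simp only [Functor.map_comp] at h
        have e1 := BiMonCat.tensorHom_comp (G.map (F.n a b)) (G.n _ _) (𝟙 (G.obj (F.obj c))) (𝟙 _)
        have e2 := BiMonCat.seqHom_comp (𝟙 (G.obj (F.obj a))) (𝟙 _) (G.m _ _) (G.map (F.m b c))
        simp only [Category.comp_id] at e1 e2
        rw [e1, e2]
        simp only [Category.assoc]
        rw [reassoc_of% h]
        have e3 := BiMonCat.n_natural G (𝟙 (F.obj a)) (F.m b c)
        have e4 := BiMonCat.m_natural G (F.n a b) (𝟙 (F.obj c))
        simp only [CategoryTheory.Functor.map_id] at e3 e4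
        rw [← e3, ← reassoc_of% e4, reassoc_of% hG.frobenius.f2] }
  mix := by
    change (G.map F.nI ≫ G.nI) ≫ E'.mix ≫ G.mI ≫ G.map F.mI = G.map (F.map D.mix)
    have h := congrArg G.map hF.mix
    simp only [Functor.map_comp] at h
    have h2 : G.functor.map E.mix = G.nI ≫ E'.mix ≫ G.mI := hG.mix.symm
    rw [h2] at h
    rw [← h]
    simp only [Category.assoc]
  units := hF.units.comp hG.units

end Categories

/-- The category of normal duoidal categories and normal bilax duoidal functors. -/
instance : Category NormalDuo.{v, u} where
  Hom := NormalDuo.Hom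
  id X := ⟨𝟙 X.toBiMonCat, IsBilax.id _, UnitsIso.id _⟩
  comp F G := ⟨F.hom ≫ G.hom, F.bilax.comp G.bilax, F.normal.comp G.normal⟩
  id_comp F := NormalDuo.Hom.ext (Category.id_comp F.hom)
  comp_id F := NormalDuo.Hom.ext (Category.comp_id F.hom)
  assoc F G H := NormalDuo.Hom.ext (Category.assoc F.hom G.hom H.hom)

/-- The category of isomix linearly distributive categories and isomix Frobenius functors. -/
instance : Category Isomix.{v, u} where
  Hom := Isomix.Hom
  id X := ⟨𝟙 X.toBiMonCat, IsIsomixFrobenius.id _⟩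
  comp F G := ⟨F.hom ≫ G.hom, F.isIsomix.comp G.isIsomix⟩
  id_comp F := Isomix.Hom.ext (Category.id_comp F.hom)
  comp_id F := Isomix.Hom.ext (Category.comp_id F.hom)
  assoc F G H := Isomix.Hom.ext (Category.assoc F.hom G.hom H.hom)

/-- The forgetful functor to categories with two monoidal structures. -/
def NormalDuo.forget : NormalDuo.{v, u} ⥤ BiMonCat.{v, u} where
  obj X := X.toBiMonCat
  map F := F.hom

/-- The forgetful functor to categories with two monoidal structures. -/
def Isomix.forget : Isomix.{v, u} ⥤ BiMonCat.{v, u} where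
  obj X := X.toBiMonCat
  map F := F.hom

/-- The linear distributors and the mix map of a normal duoidal category, built from the
interchange law and the isomorphism `k : ⊤ ≅ ⊥`. -/
noncomputable def NormalDuo.mixData (X : NormalDuo.{v, u}) : MixData X.carrier where
  distL a b c :=
    ((seqRight a).inv ⊗ₘ 𝟙 (b ⊳ c)) ≫ duo a (𝕁_ X.carrier) b c ≫
      (𝟙 (a ⊗ b) ⊳ₘ (inv (kMap X.carrier) ⊗ₘ 𝟙 c)) ≫ (𝟙 (a ⊗ b) ⊳ₘ (λ_ c).hom)
  distR b c a :=
    (𝟙 (b ⊳ c) ⊗ₘ (seqLeft a).inv) ≫ duo b c (𝕁_ X.carrier) a ≫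
      ((𝟙 b ⊗ₘ inv (kMap X.carrier)) ⊳ₘ 𝟙 (c ⊗ a)) ≫ ((ρ_ b).hom ⊳ₘ 𝟙 (c ⊗ a))
  mix := inv (kMap X.carrier)

end Duoidal

open Duoidal

/-!
A normal duoidal category is an isomix linearly distributive category because, once `k : ⊤ ⟶ ⊥` is
invertible, the interchange law can absorb a unit on either side. The starting point is
`kMap_eq_unit`: in any duoidal category `k` coincides with the unit `⊤ ⟶ ⊥` of the `⊗`-monoid `⊥`.
When it is invertible, `⊥` acts on every object on both sides (`absorbL`, `absorbR`) by transport of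
the unitors of `⊗`. These actions are natural, compatible with `⊗` (`assoc_absorbL`,
`assoc_absorbR`), given by the multiplication on `⊥` itself (`absorbL_bot`, `absorbR_bot`), and
componentwise on `⊳` (`seqLeft_inv_duo_absorbL`, `seqRight_inv_duo_absorbR`).

The distributors are the interchange law with one argument padded by `⊥`, followed by the action.
Each coherence law then reduces to one duoidal axiom plus one property of the action: the laws with
the unitors to the unit axioms of `⊳` and to the monoidality of its unitors, the laws with the
associator of `⊗` to `duo_tensor_assoc`, those with the associator of `⊳` to `duo_seq_assoc`, and
the two mixed laws likewise. In the mix law both sides are the interchange law on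
`(a ⊳ ⊥) ⊗ (⊥ ⊳ b)` followed by the two actions.

A normal bilax functor satisfies `F (k⁻¹) = n_I ≫ k⁻¹ ≫ m_I`, which is preservation of the mix map
and also shows that it respects the actions of `⊥` (`IsBilax.m_map_absorbL`,
`IsBilax.m_map_absorbR`). With compatibility with the interchange law, this gives the Frobenius
laws. The resulting functor is faithful since it does not change the underlying functors.
-/

namespace Duoidal

open DuoidalCategory

/-! ### Calculus of the two products -/

section TensorCalculus

variable {C : Type u} [Category.{v} C] [MonoidalCategory C]

theorem tensorHom_comp_id {a b c : C} (f : a ⟶ b) (g : b ⟶ c) (z : C) :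
    ((f ≫ g) ⊗ₘ 𝟙 z) = (f ⊗ₘ 𝟙 z) ≫ (g ⊗ₘ 𝟙 z) := by
  rw [tensorHom_comp_tensorHom, Category.comp_id]

theorem tensorHom_id_comp {a b c : C} (f : a ⟶ b) (g : b ⟶ c) (z : C) :
    (𝟙 z ⊗ₘ (f ≫ g)) = (𝟙 z ⊗ₘ f) ≫ (𝟙 z ⊗ₘ g) := by
  rw [tensorHom_comp_tensorHom, Category.comp_id]

end TensorCalculus

section SeqCalculus

variable {C : Type u} [Category.{v} C] [S : SeqMonoidalCategory C]

theorem seqHom_comp_seqHom {a b c a' b' c' : C} (f : a ⟶ b) (f' : a' ⟶ b') (g : b ⟶ c)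
    (g' : b' ⟶ c') : (f ⊳ₘ f') ≫ (g ⊳ₘ g') = (f ≫ g) ⊳ₘ (f' ≫ g') :=
  @MonoidalCategory.tensorHom_comp_tensorHom _ _ S.str _ _ _ _ _ _ f f' g g'

theorem seqHom_id (a b : C) : (𝟙 a ⊳ₘ 𝟙 b) = 𝟙 (a ⊳ b) :=
  @MonoidalCategory.id_tensorHom_id _ _ S.str a b

theorem seqLeft_natural {a b : C} (f : a ⟶ b) :
    (𝟙 (𝕁_ C) ⊳ₘ f) ≫ (seqLeft b).hom = (seqLeft a).hom ≫ f := by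
  have h := @MonoidalCategory.leftUnitor_naturality _ _ S.str _ _ f
  rwa [← @MonoidalCategory.id_tensorHom _ _ S.str] at h

theorem seqRight_natural {a b : C} (f : a ⟶ b) :
    (f ⊳ₘ 𝟙 (𝕁_ C)) ≫ (seqRight b).hom = (seqRight a).hom ≫ f := by
  have h := @MonoidalCategory.rightUnitor_naturality _ _ S.str _ _ f
  rwa [← @MonoidalCategory.tensorHom_id _ _ S.str] at h

theorem seqLeft_inv_natural {a b : C} (f : a ⟶ b) :
    f ≫ (seqLeft b).inv = (seqLeft a).inv ≫ (𝟙 (𝕁_ C) ⊳ₘ f) := by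
  rw [Iso.comp_inv_eq, Category.assoc, seqLeft_natural, Iso.inv_hom_id_assoc]

theorem seqRight_inv_natural {a b : C} (f : a ⟶ b) :
    f ≫ (seqRight b).inv = (seqRight a).inv ≫ (f ⊳ₘ 𝟙 (𝕁_ C)) := by
  rw [Iso.comp_inv_eq, Category.assoc, seqRight_natural, Iso.inv_hom_id_assoc]

theorem seqAssoc_natural {a a' b b' c c' : C} (f : a ⟶ a') (g : b ⟶ b') (h : c ⟶ c') :
    ((f ⊳ₘ g) ⊳ₘ h) ≫ (seqAssoc a' b' c').hom = (seqAssoc a b c).hom ≫ (f ⊳ₘ (g ⊳ₘ h)) :=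
  @MonoidalCategory.associator_naturality _ _ S.str _ _ _ _ _ _ f g h

theorem seqRight_inv_seqAssoc (a b : C) :
    (seqRight (a ⊳ b)).inv ≫ (seqAssoc a b (𝕁_ C)).hom = 𝟙 a ⊳ₘ (seqRight b).inv := by
  have h := @MonoidalCategory.rightUnitor_tensor_inv _ _ S.str a b
  rw [← @MonoidalCategory.id_tensorHom _ _ S.str] at h
  rw [← Iso.eq_comp_inv]
  exact h

theorem seqLeft_inv_seqAssoc (a b : C) :
    ((seqLeft a).inv ⊳ₘ 𝟙 b) ≫ (seqAssoc (𝕁_ C) a b).hom = (seqLeft (a ⊳ b)).inv := by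
  have h := @MonoidalCategory.leftUnitor_tensor_inv _ _ S.str a b
  rw [← @MonoidalCategory.tensorHom_id _ _ S.str] at h
  exact h.symm

theorem seqRight_inv_triangle (a b : C) :
    ((seqRight a).inv ⊳ₘ 𝟙 b) ≫ (seqAssoc a (𝕁_ C) b).hom = 𝟙 a ⊳ₘ (seqLeft b).inv := by
  have h := @MonoidalCategory.triangle_assoc_comp_right_inv _ _ S.str a b
  rwa [← @MonoidalCategory.id_tensorHom _ _ S.str, ← @MonoidalCategory.tensorHom_id _ _ S.str]
    at h

theorem seqHom_comp_id {a b c : C} (f : a ⟶ b) (g : b ⟶ c) (z : C) :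
    ((f ≫ g) ⊳ₘ 𝟙 z) = (f ⊳ₘ 𝟙 z) ≫ (g ⊳ₘ 𝟙 z) := by
  rw [seqHom_comp_seqHom, Category.comp_id]

theorem seqHom_id_comp {a b c : C} (f : a ⟶ b) (g : b ⟶ c) (z : C) :
    (𝟙 z ⊳ₘ (f ≫ g)) = (𝟙 z ⊳ₘ f) ≫ (𝟙 z ⊳ₘ g) := by
  rw [seqHom_comp_seqHom, Category.comp_id]

end SeqCalculus

/-! ### The map `k` and the unit of `⊥` -/

section Units

variable (C : Type u) [Category.{v} C] [MonoidalCategory C] [SeqMonoidalCategory C]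
  [DuoidalCategory C]

theorem seqRight_inv_top : (seqRight (𝟙_ C)).inv = eTop ≫ (𝟙 (𝟙_ C) ⊳ₘ unit) := by
  symm
  rw [← Iso.comp_hom_eq_id, Category.assoc, eTop_seqRight]

theorem seqLeft_inv_top : (seqLeft (𝟙_ C)).inv = eTop ≫ (unit ⊳ₘ 𝟙 (𝟙_ C)) := by
  symm
  rw [← Iso.comp_hom_eq_id, Category.assoc, eTop_seqLeft]

theorem eTop_tensor_eTop :
    (eTop ⊗ₘ eTop) ≫ duo (𝟙_ C) (𝟙_ C) (𝟙_ C) (𝟙_ C) ≫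
      ((λ_ (𝟙_ C)).hom ⊳ₘ (ρ_ (𝟙_ C)).hom) = (λ_ (𝟙_ C)).hom ≫ eTop := by
  have h : (eTop ⊗ₘ eTop : 𝟙_ C ⊗ 𝟙_ C ⟶ _) = (𝟙 _ ⊗ₘ eTop) ≫ (eTop ⊗ₘ 𝟙 (𝟙_ C ⊳ 𝟙_ C)) := by
    simp only [tensorHom_comp_tensorHom, Category.id_comp, Category.comp_id]
  rw [h, ← unitors_equal, Category.assoc, duo_left_unit, id_tensorHom, leftUnitor_naturality]

/-- The map `k` is the unit of the monoid `⊥`. Indeed `⊤ ≅ ⊤ ⊳ ⊥` and `⊤ ≅ ⊥ ⊳ ⊤` both factor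
through `eTop`, so `k` rewrites by naturality to `eTop ≫ (unit ⊳ unit)` followed by `⊥ ⊳ ⊥ ≅ ⊥`. -/
theorem kMap_eq_unit : kMap C = unit := by
  have e : ((seqRight (𝟙_ C)).inv ⊗ₘ (seqLeft (𝟙_ C)).inv) =
      (eTop ⊗ₘ eTop) ≫ ((𝟙 (𝟙_ C) ⊳ₘ unit) ⊗ₘ (unit ⊳ₘ 𝟙 (𝟙_ C))) := by
    rw [seqRight_inv_top, seqLeft_inv_top, tensorHom_comp_tensorHom]
  have h1 : (𝟙 (𝟙_ C) ⊗ₘ unit) ≫ (λ_ (𝕁_ C)).hom = (λ_ (𝟙_ C)).hom ≫ unit := by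
    rw [id_tensorHom, leftUnitor_naturality]
  have h2 : (unit ⊗ₘ 𝟙 (𝟙_ C)) ≫ (ρ_ (𝕁_ C)).hom = (ρ_ (𝟙_ C)).hom ≫ unit := by
    rw [tensorHom_id, rightUnitor_naturality]
  have h3 : (unit ⊳ₘ unit : 𝟙_ C ⊳ 𝟙_ C ⟶ _) =
      (unit ⊳ₘ 𝟙 (𝟙_ C)) ≫ (𝟙 (𝕁_ C) ⊳ₘ unit) := by
    rw [seqHom_comp_seqHom, Category.id_comp, Category.comp_id]
  rw [kMap, e, Category.assoc, reassoc_of% duo_natural, reassoc_of% seqHom_comp_seqHom, h1, h2,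
    ← seqHom_comp_seqHom, Category.assoc, reassoc_of% eTop_tensor_eTop, Iso.inv_hom_id_assoc, h3,
    Category.assoc, seqLeft_natural, reassoc_of% eTop_seqLeft]

variable {C}

theorem seqRight_inv_tensor (a b : C) :
    (seqRight (a ⊗ b)).inv =
      ((seqRight a).inv ⊗ₘ (seqRight b).inv) ≫ duo a (𝕁_ C) b (𝕁_ C) ≫ (𝟙 (a ⊗ b) ⊳ₘ eBot) := by
  rw [← cancel_mono (seqRight (a ⊗ b)).hom, Iso.inv_hom_id, Category.assoc, Category.assoc,
    duo_seqRight, tensorHom_comp_tensorHom, Iso.inv_hom_id, Iso.inv_hom_id, id_tensorHom_id]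

theorem seqLeft_inv_tensor (a b : C) :
    (seqLeft (a ⊗ b)).inv =
      ((seqLeft a).inv ⊗ₘ (seqLeft b).inv) ≫ duo (𝕁_ C) a (𝕁_ C) b ≫ (eBot ⊳ₘ 𝟙 (a ⊗ b)) := by
  rw [← cancel_mono (seqLeft (a ⊗ b)).hom, Iso.inv_hom_id, Category.assoc, Category.assoc,
    duo_seqLeft, tensorHom_comp_tensorHom, Iso.inv_hom_id, Iso.inv_hom_id, id_tensorHom_id]

end Units

/-! ### The action of `⊥` on objects -/

section Normal

variable {C : Type u} [Category.{v} C] [MonoidalCategory C] [SeqMonoidalCategory C]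
  [DuoidalCategory C] [IsIso (kMap C)]

instance isIso_unit : IsIso (unit : 𝟙_ C ⟶ 𝕁_ C) := by
  rw [← kMap_eq_unit]; infer_instance

/-- The left action `⊥ ⊗ c ⟶ c` of the monoid `⊥`: identify `⊥` with `⊤` along `k` and apply the
left unitor. -/
noncomputable def absorbL (c : C) : 𝕁_ C ⊗ c ⟶ c := (inv (kMap C) ⊗ₘ 𝟙 c) ≫ (λ_ c).hom

/-- The right action `c ⊗ ⊥ ⟶ c` of the monoid `⊥`: identify `⊥` with `⊤` along `k` and apply the
right unitor. -/
noncomputable def absorbR (c : C) : c ⊗ 𝕁_ C ⟶ c := (𝟙 c ⊗ₘ inv (kMap C)) ≫ (ρ_ c).hom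

theorem unit_absorbL (c : C) : (unit ⊗ₘ 𝟙 c) ≫ absorbL c = (λ_ c).hom := by
  simp [absorbL, kMap_eq_unit]

theorem unit_absorbR (c : C) : (𝟙 c ⊗ₘ unit) ≫ absorbR c = (ρ_ c).hom := by
  simp [absorbR, kMap_eq_unit]

theorem absorbL_natural {a b : C} (f : a ⟶ b) :
    (𝟙 (𝕁_ C) ⊗ₘ f) ≫ absorbL b = absorbL a ≫ f := by
  simp only [absorbL, Category.assoc, ← leftUnitor_naturality, ← id_tensorHom,
    reassoc_of% tensorHom_comp_tensorHom, Category.id_comp, Category.comp_id]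

theorem absorbR_natural {a b : C} (f : a ⟶ b) :
    (f ⊗ₘ 𝟙 (𝕁_ C)) ≫ absorbR b = absorbR a ≫ f := by
  simp only [absorbR, Category.assoc, ← rightUnitor_naturality, ← tensorHom_id,
    reassoc_of% tensorHom_comp_tensorHom, Category.id_comp, Category.comp_id]

theorem absorbL_bot : absorbL (𝕁_ C) = eBot := by
  rw [← cancel_epi (unit ⊗ₘ 𝟙 (𝕁_ C)), unit_absorbL, unit_eBot]

theorem absorbR_bot : absorbR (𝕁_ C) = eBot := by
  rw [← cancel_epi (𝟙 (𝕁_ C) ⊗ₘ unit), unit_absorbR, eBot_unit]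

theorem assoc_absorbL (a b : C) :
    (α_ (𝕁_ C) a b).hom ≫ absorbL (a ⊗ b) = absorbL a ⊗ₘ 𝟙 b := by
  simp only [absorbL, kMap_eq_unit]
  monoidal

theorem assoc_absorbR (a b : C) :
    (α_ a b (𝕁_ C)).hom ≫ (𝟙 a ⊗ₘ absorbR b) = absorbR (a ⊗ b) := by
  simp only [absorbR, kMap_eq_unit]
  monoidal

/-- The action of `⊥` on `c ⊳ d` is componentwise, through `⊥ ≅ ⊥ ⊳ ⊥`. After precomposition with
the invertible `unit`, this is the left unit law of the lax monoidal functor `⊳`. -/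
theorem seqLeft_inv_duo_absorbL (c d : C) :
    ((seqLeft (𝕁_ C)).inv ⊗ₘ 𝟙 (c ⊳ d)) ≫ duo (𝕁_ C) (𝕁_ C) c d ≫ (absorbL c ⊳ₘ absorbL d) =
      absorbL (c ⊳ d) := by
  have h : unit ≫ (seqLeft (𝕁_ C)).inv = eTop ≫ (unit ⊳ₘ unit : 𝟙_ C ⊳ 𝟙_ C ⟶ _) := by
    rw [seqLeft_inv_natural, seqLeft_inv_top, Category.assoc, seqHom_comp_seqHom,
      Category.id_comp, Category.comp_id]
  have h2 : (unit ⊗ₘ 𝟙 (c ⊳ d)) ≫ ((seqLeft (𝕁_ C)).inv ⊗ₘ 𝟙 (c ⊳ d)) =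
      (eTop ⊗ₘ 𝟙 _) ≫ ((unit ⊳ₘ unit) ⊗ₘ (𝟙 c ⊳ₘ 𝟙 d)) := by
    simp only [tensorHom_comp_tensorHom, h, seqHom_id]
  -- `unit` is invertible, so it suffices to compare after restricting the action along it.
  rw [← cancel_epi (unit ⊗ₘ 𝟙 (c ⊳ d)), unit_absorbL, reassoc_of% h2, reassoc_of% duo_natural,
    seqHom_comp_seqHom, unit_absorbL, unit_absorbL, duo_left_unit]

/-- Mirror image of `seqLeft_inv_duo_absorbL`. -/
theorem seqRight_inv_duo_absorbR (c d : C) :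
    (𝟙 (c ⊳ d) ⊗ₘ (seqRight (𝕁_ C)).inv) ≫ duo c d (𝕁_ C) (𝕁_ C) ≫ (absorbR c ⊳ₘ absorbR d) =
      absorbR (c ⊳ d) := by
  have h : unit ≫ (seqRight (𝕁_ C)).inv = eTop ≫ (unit ⊳ₘ unit : 𝟙_ C ⊳ 𝟙_ C ⟶ _) := by
    rw [seqRight_inv_natural, seqRight_inv_top, Category.assoc, seqHom_comp_seqHom,
      Category.id_comp, Category.comp_id]
  have h2 : (𝟙 (c ⊳ d) ⊗ₘ unit) ≫ (𝟙 (c ⊳ d) ⊗ₘ (seqRight (𝕁_ C)).inv) =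
      (𝟙 _ ⊗ₘ eTop) ≫ ((𝟙 c ⊳ₘ 𝟙 d) ⊗ₘ (unit ⊳ₘ unit)) := by
    simp only [tensorHom_comp_tensorHom, h, seqHom_id]
  rw [← cancel_epi (𝟙 (c ⊳ d) ⊗ₘ unit), unit_absorbR, reassoc_of% h2, reassoc_of% duo_natural,
    seqHom_comp_seqHom, unit_absorbR, unit_absorbR, duo_right_unit]

/-- The action of `⊥` is associative, its multiplication being `eBot`. -/
theorem eBot_absorbL (d : C) :
    (eBot ⊗ₘ 𝟙 d) ≫ absorbL d = (α_ (𝕁_ C) (𝕁_ C) d).hom ≫ (𝟙 _ ⊗ₘ absorbL d) ≫ absorbL d := by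
  rw [absorbL_natural, ← absorbL_bot, ← assoc_absorbL, Category.assoc]

theorem eBot_absorbR (d : C) :
    (α_ d (𝕁_ C) (𝕁_ C)).hom ≫ (𝟙 d ⊗ₘ eBot) ≫ absorbR d = (absorbR d ⊗ₘ 𝟙 _) ≫ absorbR d := by
  rw [absorbR_natural, ← absorbR_bot, reassoc_of% assoc_absorbR]

end Normal

/-! ### The distributors and their coherence laws -/

section Distributors

variable {C : Type u} [Category.{v} C] [MonoidalCategory C] [SeqMonoidalCategory C]
  [DuoidalCategory C] [IsIso (kMap C)]

/-- The left distributor `a ⊗ (b ⊳ c) ⟶ (a ⊗ b) ⊳ c` of a normal duoidal category: pad `a` to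
`a ⊳ ⊥`, interchange, and let the stray `⊥` act on `c`. -/
noncomputable def duoDistL (a b c : C) : a ⊗ (b ⊳ c) ⟶ (a ⊗ b) ⊳ c :=
  ((seqRight a).inv ⊗ₘ 𝟙 (b ⊳ c)) ≫ duo a (𝕁_ C) b c ≫ (𝟙 (a ⊗ b) ⊳ₘ absorbL c)

/-- The right distributor `(b ⊳ c) ⊗ a ⟶ b ⊳ (c ⊗ a)` of a normal duoidal category: pad `a` to
`⊥ ⊳ a`, interchange, and let the stray `⊥` act on `b`. -/
noncomputable def duoDistR (b c a : C) : (b ⊳ c) ⊗ a ⟶ b ⊳ (c ⊗ a) :=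
  (𝟙 (b ⊳ c) ⊗ₘ (seqLeft a).inv) ≫ duo b c (𝕁_ C) a ≫ (absorbR b ⊳ₘ 𝟙 (c ⊗ a))

theorem duoDistL_def (a b c : C) : duoDistL a b c =
    ((seqRight a).inv ⊗ₘ 𝟙 (b ⊳ c)) ≫ duo a (𝕁_ C) b c ≫ (𝟙 (a ⊗ b) ⊳ₘ absorbL c) := rfl

theorem duoDistR_def (b c a : C) : duoDistR b c a =
    (𝟙 (b ⊳ c) ⊗ₘ (seqLeft a).inv) ≫ duo b c (𝕁_ C) a ≫ (absorbR b ⊳ₘ 𝟙 (c ⊗ a)) := rfl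

theorem duoDistL_natural {a a' b b' c c' : C} (f : a ⟶ a') (g : b ⟶ b') (h : c ⟶ c') :
    (f ⊗ₘ (g ⊳ₘ h)) ≫ duoDistL a' b' c' = duoDistL a b c ≫ ((f ⊗ₘ g) ⊳ₘ h) := by
  have e : (f ⊗ₘ (g ⊳ₘ h)) ≫ ((seqRight a').inv ⊗ₘ 𝟙 (b' ⊳ c')) =
      ((seqRight a).inv ⊗ₘ 𝟙 (b ⊳ c)) ≫ ((f ⊳ₘ 𝟙 _) ⊗ₘ (g ⊳ₘ h)) := by
    simp only [tensorHom_comp_tensorHom, seqRight_inv_natural, Category.id_comp, Category.comp_id]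
  simp only [duoDistL, Category.assoc, reassoc_of% e, reassoc_of% duo_natural, seqHom_comp_seqHom,
    absorbL_natural, Category.id_comp, Category.comp_id]

theorem duoDistR_natural {a a' b b' c c' : C} (g : b ⟶ b') (h : c ⟶ c') (f : a ⟶ a') :
    ((g ⊳ₘ h) ⊗ₘ f) ≫ duoDistR b' c' a' = duoDistR b c a ≫ (g ⊳ₘ (h ⊗ₘ f)) := by
  have e : ((g ⊳ₘ h) ⊗ₘ f) ≫ (𝟙 (b' ⊳ c') ⊗ₘ (seqLeft a').inv) =
      (𝟙 (b ⊳ c) ⊗ₘ (seqLeft a).inv) ≫ ((g ⊳ₘ h) ⊗ₘ (𝟙 _ ⊳ₘ f)) := by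
    simp only [tensorHom_comp_tensorHom, seqLeft_inv_natural, Category.id_comp, Category.comp_id]
  simp only [duoDistR, Category.assoc, reassoc_of% e, reassoc_of% duo_natural, seqHom_comp_seqHom,
    absorbR_natural, Category.id_comp, Category.comp_id]

theorem duoDistL_leftUnitor (b c : C) :
    duoDistL (𝟙_ C) b c ≫ ((λ_ b).hom ⊳ₘ 𝟙 c) = (λ_ (b ⊳ c)).hom := by
  have e : ((seqRight (𝟙_ C)).inv ⊗ₘ 𝟙 (b ⊳ c)) =
      (eTop ⊗ₘ 𝟙 _) ≫ ((𝟙 (𝟙_ C) ⊳ₘ unit) ⊗ₘ (𝟙 b ⊳ₘ 𝟙 c)) := by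
    rw [seqRight_inv_top, seqHom_id, tensorHom_comp_id]
  simp only [duoDistL, Category.assoc, e, reassoc_of% duo_natural, seqHom_comp_seqHom,
    unit_absorbL, Category.id_comp, Category.comp_id, id_tensorHom_id, duo_left_unit]

theorem duoDistR_rightUnitor (b c : C) :
    duoDistR b c (𝟙_ C) ≫ (𝟙 b ⊳ₘ (ρ_ c).hom) = (ρ_ (b ⊳ c)).hom := by
  have e : (𝟙 (b ⊳ c) ⊗ₘ (seqLeft (𝟙_ C)).inv) =
      (𝟙 _ ⊗ₘ eTop) ≫ ((𝟙 b ⊳ₘ 𝟙 c) ⊗ₘ (unit ⊳ₘ 𝟙 (𝟙_ C))) := by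
    rw [seqLeft_inv_top, seqHom_id, tensorHom_id_comp]
  simp only [duoDistR, Category.assoc, e, reassoc_of% duo_natural, seqHom_comp_seqHom,
    unit_absorbR, Category.id_comp, Category.comp_id, id_tensorHom_id, duo_right_unit]

theorem duoDistL_seqRight (a b : C) :
    duoDistL a b (𝕁_ C) ≫ (seqRight (a ⊗ b)).hom = 𝟙 a ⊗ₘ (seqRight b).hom := by
  simp only [duoDistL, Category.assoc, absorbL_bot, duo_seqRight, tensorHom_comp_tensorHom,
    Iso.inv_hom_id, Category.id_comp]

theorem duoDistR_seqLeft (c a : C) :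
    duoDistR (𝕁_ C) c a ≫ (seqLeft (c ⊗ a)).hom = (seqLeft c).hom ⊗ₘ 𝟙 a := by
  simp only [duoDistR, Category.assoc, absorbR_bot, duo_seqLeft, tensorHom_comp_tensorHom,
    Iso.inv_hom_id, Category.id_comp]

/-- The two insertions of `⊥` on the right-hand side correspond, by monoidality of the right unitor
of `⊳`, to a single one on `a ⊗ b`; the two actions on `d` agree because `absorbL` is associative.
-/
theorem duoDistL_assoc (a b c d : C) :
    duoDistL (a ⊗ b) c d ≫ ((α_ a b c).hom ⊳ₘ 𝟙 d) =
      (α_ a b (c ⊳ d)).hom ≫ (𝟙 a ⊗ₘ duoDistL b c d) ≫ duoDistL a (b ⊗ c) d := by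
  have e1 : ((seqRight (a ⊗ b)).inv ⊗ₘ 𝟙 (c ⊳ d)) =
      (((seqRight a).inv ⊗ₘ (seqRight b).inv) ⊗ₘ 𝟙 (c ⊳ d)) ≫
        (duo a (𝕁_ C) b (𝕁_ C) ⊗ₘ 𝟙 (c ⊳ d)) ≫ ((𝟙 (a ⊗ b) ⊳ₘ eBot) ⊗ₘ (𝟙 c ⊳ₘ 𝟙 d)) := by
    rw [seqRight_inv_tensor, seqHom_id, tensorHom_comp_id, tensorHom_comp_id]
  have e2 : (𝟙 a ⊗ₘ duoDistL b c d) ≫ ((seqRight a).inv ⊗ₘ 𝟙 ((b ⊗ c) ⊳ d)) =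
      ((seqRight a).inv ⊗ₘ ((seqRight b).inv ⊗ₘ 𝟙 (c ⊳ d))) ≫
        (𝟙 (a ⊳ 𝕁_ C) ⊗ₘ duo b (𝕁_ C) c d) ≫
          ((𝟙 a ⊳ₘ 𝟙 (𝕁_ C)) ⊗ₘ (𝟙 (b ⊗ c) ⊳ₘ absorbL d)) := by
    simp only [seqHom_id, tensorHom_comp_tensorHom, Category.id_comp, Category.comp_id, duoDistL]
  have e3 : (𝟙 ((a ⊗ b) ⊗ c) ⊳ₘ (eBot ⊗ₘ 𝟙 d)) ≫ (𝟙 ((a ⊗ b) ⊗ c) ⊳ₘ absorbL d) ≫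
      ((α_ a b c).hom ⊳ₘ 𝟙 d) =
      ((α_ a b c).hom ⊳ₘ (α_ (𝕁_ C) (𝕁_ C) d).hom) ≫
        (𝟙 _ ⊳ₘ (𝟙 (𝕁_ C) ⊗ₘ absorbL d)) ≫ (𝟙 _ ⊳ₘ absorbL d) := by
    simp only [seqHom_comp_seqHom, Category.id_comp, Category.comp_id, eBot_absorbL]
  rw [duoDistL_def (a ⊗ b), duoDistL_def a, e1, reassoc_of% e2]
  simp only [Category.assoc, reassoc_of% duo_natural, id_tensorHom_id]
  rw [e3, reassoc_of% duo_tensor_assoc, reassoc_of% associator_naturality]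

theorem duoDistR_assoc (a b c d : C) :
    (α_ (a ⊳ b) c d).hom ≫ duoDistR a b (c ⊗ d) =
      (duoDistR a b c ⊗ₘ 𝟙 d) ≫ duoDistR a (b ⊗ c) d ≫ (𝟙 a ⊳ₘ (α_ b c d).hom) := by
  have e1 : (𝟙 (a ⊳ b) ⊗ₘ (seqLeft (c ⊗ d)).inv) =
      (𝟙 (a ⊳ b) ⊗ₘ ((seqLeft c).inv ⊗ₘ (seqLeft d).inv)) ≫
        (𝟙 (a ⊳ b) ⊗ₘ duo (𝕁_ C) c (𝕁_ C) d) ≫ ((𝟙 a ⊳ₘ 𝟙 b) ⊗ₘ (eBot ⊳ₘ 𝟙 (c ⊗ d))) := by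
    rw [seqLeft_inv_tensor, seqHom_id, tensorHom_id_comp, tensorHom_id_comp]
  have e2 : (duoDistR a b c ⊗ₘ 𝟙 d) ≫ (𝟙 (a ⊳ (b ⊗ c)) ⊗ₘ (seqLeft d).inv) =
      ((𝟙 (a ⊳ b) ⊗ₘ (seqLeft c).inv) ⊗ₘ (seqLeft d).inv) ≫
        (duo a b (𝕁_ C) c ⊗ₘ 𝟙 (𝕁_ C ⊳ d)) ≫
          ((absorbR a ⊳ₘ 𝟙 (b ⊗ c)) ⊗ₘ (𝟙 (𝕁_ C) ⊳ₘ 𝟙 d)) := by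
    simp only [seqHom_id, tensorHom_comp_tensorHom, Category.id_comp, Category.comp_id, duoDistR]
  have e3 : ((absorbR a ⊗ₘ 𝟙 (𝕁_ C)) ⊳ₘ 𝟙 ((b ⊗ c) ⊗ d)) ≫ (absorbR a ⊳ₘ 𝟙 ((b ⊗ c) ⊗ d)) ≫
      (𝟙 a ⊳ₘ (α_ b c d).hom) =
      ((α_ a (𝕁_ C) (𝕁_ C)).hom ⊳ₘ (α_ b c d).hom) ≫
        ((𝟙 a ⊗ₘ eBot) ⊳ₘ 𝟙 _) ≫ (absorbR a ⊳ₘ 𝟙 _) := by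
    simp only [seqHom_comp_seqHom, Category.id_comp, Category.comp_id, eBot_absorbR]
  rw [duoDistR_def a b (c ⊗ d), duoDistR_def a (b ⊗ c), e1]
  simp only [Category.assoc]
  rw [reassoc_of% e2]
  simp only [reassoc_of% duo_natural, id_tensorHom_id]
  rw [e3, reassoc_of% duo_tensor_assoc, reassoc_of% associator_naturality]

/-- On the left `⊥` is inserted twice and each copy is absorbed separately; on the right a single
`⊥ ≅ ⊥ ⊳ ⊥` acts on `c ⊳ d`, which is the same by `seqLeft_inv_duo_absorbL`. -/
theorem duoDistL_seqAssoc (a b c d : C) :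
    duoDistL a (b ⊳ c) d ≫ (duoDistL a b c ⊳ₘ 𝟙 d) ≫ (seqAssoc (a ⊗ b) c d).hom =
      (𝟙 a ⊗ₘ (seqAssoc b c d).hom) ≫ duoDistL a b (c ⊳ d) := by
  have e1 : (𝟙 (a ⊗ (b ⊳ c)) ⊳ₘ absorbL d) ≫ (duoDistL a b c ⊳ₘ 𝟙 d) =
      (((seqRight a).inv ⊗ₘ 𝟙 (b ⊳ c)) ⊳ₘ (𝟙 (𝕁_ C) ⊗ₘ 𝟙 d)) ≫
        (duo a (𝕁_ C) b c ⊳ₘ 𝟙 (𝕁_ C ⊗ d)) ≫ ((𝟙 (a ⊗ b) ⊳ₘ absorbL c) ⊳ₘ absorbL d) := by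
    simp only [duoDistL, seqHom_comp_seqHom, Category.id_comp, Category.comp_id, id_tensorHom_id]
  have e2 : ((seqRight a).inv ⊗ₘ 𝟙 ((b ⊳ c) ⊳ d)) ≫
      (((seqRight a).inv ⊳ₘ 𝟙 (𝕁_ C)) ⊗ₘ (𝟙 (b ⊳ c) ⊳ₘ 𝟙 d)) ≫
        ((seqAssoc a (𝕁_ C) (𝕁_ C)).hom ⊗ₘ (seqAssoc b c d).hom) =
      (𝟙 a ⊗ₘ (seqAssoc b c d).hom) ≫ ((seqRight a).inv ⊗ₘ 𝟙 (b ⊳ (c ⊳ d))) ≫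
        ((𝟙 a ⊳ₘ (seqLeft (𝕁_ C)).inv) ⊗ₘ (𝟙 b ⊳ₘ 𝟙 (c ⊳ d))) := by
    simp only [seqHom_id, tensorHom_comp_tensorHom, Category.id_comp, Category.comp_id,
      seqRight_inv_triangle]
  rw [duoDistL_def a (b ⊳ c), Category.assoc, Category.assoc, reassoc_of% e1, seqAssoc_natural,
    ← reassoc_of% duo_natural, reassoc_of% duo_seq_assoc, reassoc_of% e2, reassoc_of% duo_natural,
    duoDistL_def a b (c ⊳ d),
    ← seqLeft_inv_duo_absorbL, seqHom_id_comp, seqHom_id_comp, id_tensorHom_id]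

theorem duoDistR_seqAssoc (b c d a : C) :
    duoDistR (b ⊳ c) d a ≫ (seqAssoc b c (d ⊗ a)).hom =
      ((seqAssoc b c d).hom ⊗ₘ 𝟙 a) ≫ duoDistR b (c ⊳ d) a ≫ (𝟙 b ⊳ₘ duoDistR c d a) := by
  have e1 : (absorbR b ⊳ₘ 𝟙 ((c ⊳ d) ⊗ a)) ≫ (𝟙 b ⊳ₘ duoDistR c d a) =
      ((𝟙 b ⊗ₘ 𝟙 (𝕁_ C)) ⊳ₘ (𝟙 (c ⊳ d) ⊗ₘ (seqLeft a).inv)) ≫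
        (𝟙 (b ⊗ 𝕁_ C) ⊳ₘ duo c d (𝕁_ C) a) ≫ (absorbR b ⊳ₘ (absorbR c ⊳ₘ 𝟙 (d ⊗ a))) := by
    simp only [duoDistR, seqHom_comp_seqHom, Category.id_comp, Category.comp_id, id_tensorHom_id]
  have e2 : ((seqAssoc b c d).hom ⊗ₘ 𝟙 a) ≫ (𝟙 (b ⊳ (c ⊳ d)) ⊗ₘ (seqLeft a).inv) ≫
      ((𝟙 b ⊳ₘ 𝟙 (c ⊳ d)) ⊗ₘ (𝟙 (𝕁_ C) ⊳ₘ (seqLeft a).inv)) =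
      (𝟙 ((b ⊳ c) ⊳ d) ⊗ₘ (seqLeft a).inv) ≫
        ((𝟙 (b ⊳ c) ⊳ₘ 𝟙 d) ⊗ₘ ((seqRight (𝕁_ C)).inv ⊳ₘ 𝟙 a)) ≫
          ((seqAssoc b c d).hom ⊗ₘ (seqAssoc (𝕁_ C) (𝕁_ C) a).hom) := by
    simp only [seqHom_id, tensorHom_comp_tensorHom, Category.id_comp, Category.comp_id,
      seqRight_inv_triangle]
  rw [duoDistR_def (b ⊳ c), duoDistR_def b (c ⊳ d)]
  simp only [Category.assoc]
  rw [e1,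
    ← reassoc_of% duo_natural, reassoc_of% e2, ← reassoc_of% duo_seq_assoc, ← seqAssoc_natural,
    reassoc_of% duo_natural, ← seqRight_inv_duo_absorbR, seqHom_comp_id, seqHom_comp_id,
    id_tensorHom_id]
  simp only [Category.assoc]

/-- The paddings of `a` and `d` do not interfere: both sides interchange
`(a ⊳ ⊥) ⊗ (b ⊳ c) ⊗ (⊥ ⊳ d)`, then act on `b` from the right and on `c` from the left. -/
theorem duoDistL_duoDistR (a b c d : C) :
    (duoDistL a b c ⊗ₘ 𝟙 d) ≫ duoDistR (a ⊗ b) c d =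
      (α_ a (b ⊳ c) d).hom ≫ (𝟙 a ⊗ₘ duoDistR b c d) ≫ duoDistL a b (c ⊗ d) := by
  have e1 : (duoDistL a b c ⊗ₘ 𝟙 d) ≫ (𝟙 ((a ⊗ b) ⊳ c) ⊗ₘ (seqLeft d).inv) =
      (((seqRight a).inv ⊗ₘ 𝟙 (b ⊳ c)) ⊗ₘ (seqLeft d).inv) ≫
        (duo a (𝕁_ C) b c ⊗ₘ 𝟙 (𝕁_ C ⊳ d)) ≫
          ((𝟙 (a ⊗ b) ⊳ₘ absorbL c) ⊗ₘ (𝟙 (𝕁_ C) ⊳ₘ 𝟙 d)) := by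
    simp only [seqHom_id, tensorHom_comp_tensorHom, Category.id_comp, Category.comp_id, duoDistL]
  have e2 : (𝟙 a ⊗ₘ duoDistR b c d) ≫ ((seqRight a).inv ⊗ₘ 𝟙 (b ⊳ (c ⊗ d))) =
      ((seqRight a).inv ⊗ₘ (𝟙 (b ⊳ c) ⊗ₘ (seqLeft d).inv)) ≫
        (𝟙 (a ⊳ 𝕁_ C) ⊗ₘ duo b c (𝕁_ C) d) ≫
          ((𝟙 a ⊳ₘ 𝟙 (𝕁_ C)) ⊗ₘ (absorbR b ⊳ₘ 𝟙 (c ⊗ d))) := by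
    simp only [seqHom_id, tensorHom_comp_tensorHom, Category.id_comp, Category.comp_id, duoDistR]
  have e3 : ((𝟙 (a ⊗ b) ⊗ₘ 𝟙 (𝕁_ C)) ⊳ₘ (absorbL c ⊗ₘ 𝟙 d)) ≫
      (absorbR (a ⊗ b) ⊳ₘ 𝟙 (c ⊗ d)) =
      ((α_ a b (𝕁_ C)).hom ⊳ₘ (α_ (𝕁_ C) c d).hom) ≫
        ((𝟙 a ⊗ₘ absorbR b) ⊳ₘ (𝟙 (𝕁_ C) ⊗ₘ 𝟙 (c ⊗ d))) ≫ (𝟙 (a ⊗ b) ⊳ₘ absorbL (c ⊗ d)) := by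
    simp only [seqHom_comp_seqHom, Category.id_comp, Category.comp_id, id_tensorHom_id,
      assoc_absorbL, assoc_absorbR]
  rw [duoDistR_def (a ⊗ b), duoDistL_def a b (c ⊗ d), reassoc_of% e1, reassoc_of% e2, reassoc_of% duo_natural,
    reassoc_of% duo_natural, e3, reassoc_of% duo_tensor_assoc, reassoc_of% associator_naturality]

/-- Both sides interchange `(a ⊳ b ⊳ ⊥) ⊗ (⊥ ⊳ c ⊳ d)` in its three `⊳`-components, and then act on
`a` from the right and on `d` from the left. -/
theorem duoDistR_duoDistL (a b c d : C) :
    duoDistL (a ⊳ b) c d ≫ (duoDistR a b c ⊳ₘ 𝟙 d) ≫ (seqAssoc a (b ⊗ c) d).hom =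
      duoDistR a b (c ⊳ d) ≫ (𝟙 a ⊳ₘ duoDistL b c d) := by
  have e1 : (𝟙 ((a ⊳ b) ⊗ c) ⊳ₘ absorbL d) ≫ (duoDistR a b c ⊳ₘ 𝟙 d) =
      ((𝟙 (a ⊳ b) ⊗ₘ (seqLeft c).inv) ⊳ₘ (𝟙 (𝕁_ C) ⊗ₘ 𝟙 d)) ≫
        (duo a b (𝕁_ C) c ⊳ₘ 𝟙 (𝕁_ C ⊗ d)) ≫ ((absorbR a ⊳ₘ 𝟙 (b ⊗ c)) ⊳ₘ absorbL d) := by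
    simp only [duoDistR, seqHom_comp_seqHom, Category.id_comp, Category.comp_id, id_tensorHom_id]
  have e1' : (absorbR a ⊳ₘ 𝟙 (b ⊗ (c ⊳ d))) ≫ (𝟙 a ⊳ₘ duoDistL b c d) =
      ((𝟙 a ⊗ₘ 𝟙 (𝕁_ C)) ⊳ₘ ((seqRight b).inv ⊗ₘ 𝟙 (c ⊳ d))) ≫
        (𝟙 (a ⊗ 𝕁_ C) ⊳ₘ duo b (𝕁_ C) c d) ≫ (absorbR a ⊳ₘ (𝟙 (b ⊗ c) ⊳ₘ absorbL d)) := by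
    simp only [duoDistL, seqHom_comp_seqHom, Category.id_comp, Category.comp_id, id_tensorHom_id]
  have e2 : ((seqRight (a ⊳ b)).inv ⊗ₘ 𝟙 (c ⊳ d)) ≫
      ((𝟙 (a ⊳ b) ⊳ₘ 𝟙 (𝕁_ C)) ⊗ₘ ((seqLeft c).inv ⊳ₘ 𝟙 d)) ≫
        ((seqAssoc a b (𝕁_ C)).hom ⊗ₘ (seqAssoc (𝕁_ C) c d).hom) =
      (𝟙 (a ⊳ b) ⊗ₘ (seqLeft (c ⊳ d)).inv) ≫
        ((𝟙 a ⊳ₘ (seqRight b).inv) ⊗ₘ (𝟙 (𝕁_ C) ⊳ₘ 𝟙 (c ⊳ d))) := by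
    simp only [seqHom_id, tensorHom_comp_tensorHom, Category.id_comp, Category.comp_id,
      seqRight_inv_seqAssoc, seqLeft_inv_seqAssoc]
  rw [duoDistL_def (a ⊳ b), duoDistR_def a b (c ⊳ d)]
  simp only [Category.assoc]
  rw [reassoc_of% e1, seqAssoc_natural, ← reassoc_of% duo_natural, reassoc_of% duo_seq_assoc,
    reassoc_of% e2, reassoc_of% duo_natural, e1']

end Distributors

theorem NormalDuo.mixData_distL (X : NormalDuo.{v, u}) (a b c : X.carrier) :
    X.mixData.distL a b c = duoDistL a b c := by
  simp only [NormalDuo.mixData, duoDistL, absorbL, seqHom_id_comp]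

theorem NormalDuo.mixData_distR (X : NormalDuo.{v, u}) (b c a : X.carrier) :
    X.mixData.distR b c a = duoDistR b c a := by
  simp only [NormalDuo.mixData, duoDistR, absorbR, seqHom_comp_id]

theorem NormalDuo.isLDC (X : NormalDuo.{v, u}) : X.mixData.IsLDC := by
  constructor <;> intros <;> simp only [mixData_distL, mixData_distR]
  · exact duoDistL_natural _ _ _
  · exact duoDistR_natural _ _ _
  · exact duoDistL_leftUnitor _ _
  · exact duoDistR_rightUnitor _ _
  · exact duoDistL_seqRight _ _
  · exact duoDistR_seqLeft _ _
  · exact duoDistL_assoc _ _ _ _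
  · exact duoDistR_assoc _ _ _ _
  · exact duoDistL_seqAssoc _ _ _ _
  · exact duoDistR_seqAssoc _ _ _ _
  · exact duoDistL_duoDistR _ _ _ _
  · exact duoDistR_duoDistL _ _ _ _

theorem NormalDuo.isMix (X : NormalDuo.{v, u}) : X.mixData.IsMix := by
  intro a b
  have hm : X.mixData.mix = inv (kMap X.carrier) := rfl
  have e1 : (𝟙 a ⊗ₘ (seqLeft b).inv) ≫ (𝟙 a ⊗ₘ (inv (kMap X.carrier) ⊳ₘ 𝟙 b)) ≫
      ((seqRight a).inv ⊗ₘ 𝟙 (𝟙_ X.carrier ⊳ b)) =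
      ((seqRight a).inv ⊗ₘ (seqLeft b).inv) ≫
        ((𝟙 a ⊳ₘ 𝟙 _) ⊗ₘ (inv (kMap X.carrier) ⊳ₘ 𝟙 b)) := by
    simp only [seqHom_id, tensorHom_comp_tensorHom, Category.id_comp, Category.comp_id]
  have e2 : ((seqRight a).inv ⊗ₘ 𝟙 b) ≫ (𝟙 (a ⊳ 𝕁_ X.carrier) ⊗ₘ (seqLeft b).inv) =
      ((seqRight a).inv ⊗ₘ (seqLeft b).inv) := by
    simp only [tensorHom_comp_tensorHom, Category.id_comp, Category.comp_id]
  rw [mixData_distL, mixData_distR, hm, duoDistL, duoDistR]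
  simp only [Category.assoc]
  -- Both sides are now the interchange law on `(a ⊳ ⊥) ⊗ (⊥ ⊳ b)` followed by `absorbR ⊳ absorbL`.
  rw [reassoc_of% e1, reassoc_of% e2, reassoc_of% duo_natural]
  simp only [seqHom_comp_seqHom, Category.id_comp, Category.comp_id, id_tensorHom_id, absorbL,
    absorbR]

theorem NormalDuo.isIsomixLDC (X : NormalDuo.{v, u}) : X.mixData.IsIsomixLDC :=
  ⟨X.isLDC, X.isMix, inferInstanceAs (IsIso (inv (kMap X.carrier)))⟩

/-! ### Normal bilax duoidal functors are isomix Frobenius functors -/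

section Functors

variable {X Y : BiMonCat.{v, u}} (F : X ⟶ Y)

theorem BiMonCat.seqRight_inv_n (a : X.carrier) :
    F.map (seqRight a).inv ≫ F.n a (𝕁_ X.carrier) ≫ (𝟙 (F.obj a) ⊳ₘ F.nI) =
      (seqRight (F.obj a)).inv := by
  have h := @Functor.OplaxMonoidal.right_unitality _ _ X.seq.str _ _ Y.seq.str F.functor F.colax a
  rw [← @MonoidalCategory.id_tensorHom _ _ Y.seq.str] at h
  exact h.symm

theorem BiMonCat.seqLeft_inv_n (a : X.carrier) :
    F.map (seqLeft a).inv ≫ F.n (𝕁_ X.carrier) a ≫ (F.nI ⊳ₘ 𝟙 (F.obj a)) =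
      (seqLeft (F.obj a)).inv := by
  have h := @Functor.OplaxMonoidal.left_unitality _ _ X.seq.str _ _ Y.seq.str F.functor F.colax a
  rw [← @MonoidalCategory.tensorHom_id _ _ Y.seq.str] at h
  exact h.symm

theorem BiMonCat.mI_m_leftUnitor (a : X.carrier) :
    (F.mI ⊗ₘ 𝟙 (F.obj a)) ≫ F.m (𝟙_ X.carrier) a ≫ F.map (λ_ a).hom = (λ_ (F.obj a)).hom := by
  have h := @Functor.LaxMonoidal.left_unitality _ _ _ _ _ _ F.functor F.lax a
  rw [← tensorHom_id] at h
  exact h.symm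

theorem BiMonCat.mI_m_rightUnitor (a : X.carrier) :
    (𝟙 (F.obj a) ⊗ₘ F.mI) ≫ F.m a (𝟙_ X.carrier) ≫ F.map (ρ_ a).hom = (ρ_ (F.obj a)).hom := by
  have h := @Functor.LaxMonoidal.right_unitality _ _ _ _ _ _ F.functor F.lax a
  rw [← id_tensorHom] at h
  exact h.symm

variable {F} [DuoidalCategory X.carrier] [DuoidalCategory Y.carrier]
  [IsIso (kMap X.carrier)] [IsIso (kMap Y.carrier)]

/-- The inverse form of the compatibility of `F` with `k`. -/
theorem IsBilax.map_inv_kMap (hF : IsBilax F) (hU : UnitsIso F) :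
    F.nI ≫ inv (kMap Y.carrier) ≫ F.mI = F.map (inv (kMap X.carrier)) := by
  obtain ⟨_, _⟩ := hU
  have h : inv (kMap Y.carrier) = inv (F.mI ≫ F.map (kMap X.carrier) ≫ F.nI) := by
    simp only [hF.d4]
  rw [h]
  simp

/-- `F` intertwines the actions of `⊥`, along `F ⊥ ⟶ ⊥`. -/
theorem IsBilax.m_map_absorbL (hF : IsBilax F) (hU : UnitsIso F) (c : X.carrier) :
    F.m (𝕁_ X.carrier) c ≫ F.map (absorbL c) = (F.nI ⊗ₘ 𝟙 (F.obj c)) ≫ absorbL (F.obj c) := by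
  have h := BiMonCat.m_natural F (inv (kMap X.carrier)) (𝟙 c)
  simp only [← hF.map_inv_kMap hU, CategoryTheory.Functor.map_id] at h
  rw [absorbL]
  simp only [Functor.map_comp]
  rw [← reassoc_of% h, absorbL, ← BiMonCat.mI_m_leftUnitor]
  simp only [reassoc_of% tensorHom_comp_tensorHom, Category.comp_id]

theorem IsBilax.m_map_absorbR (hF : IsBilax F) (hU : UnitsIso F) (c : X.carrier) :
    F.m c (𝕁_ X.carrier) ≫ F.map (absorbR c) = (𝟙 (F.obj c) ⊗ₘ F.nI) ≫ absorbR (F.obj c) := by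
  have h := BiMonCat.m_natural F (𝟙 c) (inv (kMap X.carrier))
  simp only [← hF.map_inv_kMap hU, CategoryTheory.Functor.map_id] at h
  rw [absorbR]
  simp only [Functor.map_comp]
  rw [← reassoc_of% h, absorbR, ← BiMonCat.mI_m_rightUnitor]
  simp only [reassoc_of% tensorHom_comp_tensorHom, Category.comp_id]

theorem IsBilax.map_duoDistL (hF : IsBilax F) (hU : UnitsIso F) (a b c : X.carrier) :
    F.m a (b ⊳ c) ≫ F.map (duoDistL a b c) ≫ F.n (a ⊗ b) c =
      (𝟙 (F.obj a) ⊗ₘ F.n b c) ≫ duoDistL (F.obj a) (F.obj b) (F.obj c) ≫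
        (F.m a b ⊳ₘ 𝟙 (F.obj c)) := by
  have h1 := BiMonCat.m_natural F (seqRight a).inv (𝟙 (b ⊳ c))
  have h2 := BiMonCat.n_natural F (𝟙 (a ⊗ b)) (absorbL c)
  simp only [CategoryTheory.Functor.map_id] at h1 h2
  have h3 : (F.m a b ⊳ₘ F.m (𝕁_ X.carrier) c) ≫ (𝟙 (F.obj (a ⊗ b)) ⊳ₘ F.map (absorbL c)) =
      ((𝟙 (F.obj a) ⊗ₘ 𝟙 (F.obj b)) ⊳ₘ (F.nI ⊗ₘ 𝟙 (F.obj c))) ≫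
        (𝟙 _ ⊳ₘ absorbL (F.obj c)) ≫ (F.m a b ⊳ₘ 𝟙 (F.obj c)) := by
    simp only [seqHom_comp_seqHom, hF.m_map_absorbL hU, id_tensorHom_id, Category.id_comp,
      Category.comp_id]
  have h4 : (F.map (seqRight a).inv ⊗ₘ 𝟙 (F.obj (b ⊳ c))) ≫
      (F.n a (𝕁_ X.carrier) ⊗ₘ F.n b c) ≫
        ((𝟙 (F.obj a) ⊳ₘ F.nI) ⊗ₘ (𝟙 (F.obj b) ⊳ₘ 𝟙 (F.obj c))) =
      (𝟙 (F.obj a) ⊗ₘ F.n b c) ≫ ((seqRight (F.obj a)).inv ⊗ₘ 𝟙 _) := by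
    simp only [seqHom_id, tensorHom_comp_tensorHom, BiMonCat.seqRight_inv_n, Category.id_comp,
      Category.comp_id]
  simp only [duoDistL, Functor.map_comp, Category.assoc]
  rw [← reassoc_of% h1, ← h2, reassoc_of% hF.d1, h3, ← reassoc_of% duo_natural, reassoc_of% h4]

theorem IsBilax.map_duoDistR (hF : IsBilax F) (hU : UnitsIso F) (a b c : X.carrier) :
    F.m (a ⊳ b) c ≫ F.map (duoDistR a b c) ≫ F.n a (b ⊗ c) =
      (F.n a b ⊗ₘ 𝟙 (F.obj c)) ≫ duoDistR (F.obj a) (F.obj b) (F.obj c) ≫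
        (𝟙 (F.obj a) ⊳ₘ F.m b c) := by
  have h1 := BiMonCat.m_natural F (𝟙 (a ⊳ b)) (seqLeft c).inv
  have h2 := BiMonCat.n_natural F (absorbR a) (𝟙 (b ⊗ c))
  simp only [CategoryTheory.Functor.map_id] at h1 h2
  have h3 : (F.m a (𝕁_ X.carrier) ⊳ₘ F.m b c) ≫ (F.map (absorbR a) ⊳ₘ 𝟙 (F.obj (b ⊗ c))) =
      ((𝟙 (F.obj a) ⊗ₘ F.nI) ⊳ₘ (𝟙 (F.obj b) ⊗ₘ 𝟙 (F.obj c))) ≫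
        (absorbR (F.obj a) ⊳ₘ 𝟙 _) ≫ (𝟙 (F.obj a) ⊳ₘ F.m b c) := by
    simp only [seqHom_comp_seqHom, hF.m_map_absorbR hU, id_tensorHom_id, Category.id_comp,
      Category.comp_id]
  have h4 : (𝟙 (F.obj (a ⊳ b)) ⊗ₘ F.map (seqLeft c).inv) ≫
      (F.n a b ⊗ₘ F.n (𝕁_ X.carrier) c) ≫
        ((𝟙 (F.obj a) ⊳ₘ 𝟙 (F.obj b)) ⊗ₘ (F.nI ⊳ₘ 𝟙 (F.obj c))) =
      (F.n a b ⊗ₘ 𝟙 (F.obj c)) ≫ (𝟙 _ ⊗ₘ (seqLeft (F.obj c)).inv) := by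
    simp only [seqHom_id, tensorHom_comp_tensorHom, BiMonCat.seqLeft_inv_n, Category.id_comp,
      Category.comp_id]
  simp only [duoDistR, Functor.map_comp, Category.assoc]
  rw [← reassoc_of% h1, ← h2, reassoc_of% hF.d1, h3, ← reassoc_of% duo_natural, reassoc_of% h4]

end Functors

theorem NormalDuo.Hom.isIsomixFrobenius {X Y : NormalDuo.{v, u}} (F : NormalDuo.Hom X Y) :
    IsIsomixFrobenius X.mixData Y.mixData F.hom where
  frobenius :=
    { f1 a b c := by
        simp only [NormalDuo.mixData_distL]
        exact F.bilax.map_duoDistL F.normal a b c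
      f2 a b c := by
        simp only [NormalDuo.mixData_distR]
        exact F.bilax.map_duoDistR F.normal a b c }
  mix := F.bilax.map_inv_kMap F.normal
  units := F.normal

/-- The functor from normal duoidal categories to isomix linearly distributive categories that
keeps the monoidal structures and the underlying lax and colax functors. -/
noncomputable def NormalDuo.toIsomix : NormalDuo.{v, u} ⥤ Isomix.{v, u} where
  obj X := ⟨X.toBiMonCat, X.mixData, X.isIsomixLDC⟩
  map F := ⟨F.hom, F.isIsomixFrobenius⟩

instance NormalDuo.toIsomix_faithful : NormalDuo.toIsomix.{v, u}.Faithful where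
  map_injective h := NormalDuo.Hom.ext (congrArg Isomix.Hom.hom h)

end Duoidal

open Duoidal
theorem lemma3p3 :
    ∃ H : NormalDuo.{v, u} ⥤ Isomix.{v, u},
      H.Faithful ∧
      H ⋙ Isomix.forget = NormalDuo.forget ∧
      (∀ X : NormalDuo.{v, u}, ∃ h : X.mixData.IsIsomixLDC,
        H.obj X = Isomix.mk X.toBiMonCat X.mixData h) ∧
      (∀ (X Y : NormalDuo.{v, u}) (F : X ⟶ Y),
        IsIsomixFrobenius X.mixData Y.mixData (NormalDuo.forget.map F)) :=
  ⟨NormalDuo.toIsomix, inferInstance, rfl, fun X => ⟨X.isIsomixLDC, rfl⟩,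
    fun _ _ F => NormalDuo.Hom.isIsomixFrobenius F⟩
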